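/- Let $f:\mathbb{R}^n\to[0,\infty)$ be an even, integrable, log-concave function, i.e. $f=e^{-\psi}$ with $\psi:\mathbb{R}^n\to\mathbb{R}\cup\{\infty\}$ convex and $\psi(-x)=\psi(x)$, and suppose that $f$ is nondegenerate, i.e. $\operatorname{int}(\operatorname{supp} f)\neq\emptyset$. For a function $g:\mathbb{R}^n\to[0,\infty)$ let $g^\circ(y)=\inf_{x\in\operatorname{supp} g} e^{-\langle x,y\rangle}/g(x)$ denote its polar, let $\mathcal{A}$ be the set of all nonsingular affine maps $A=T+a$ of $\mathbb{R}^n$ (with $T\in GL(n)$, $a\in\mathbb{R}^n$ and $\det A:=\det T$), and let $B_2^n$ be the closed Euclidean unit ball. A Löwner function of $f$ is a function $x\mapsto e^{-\|A_0x\|_2+t_0}$, where $(A_0,t_0)\in\mathcal{A}\times\mathbb{R}$ minimizes $\int_{\mathbb{R}^n}e^{-\|Ax\|_2+t}\,dx$ among all $(A,t)\in\mathcal{A}\times\mathbb{R}$ with $e^{-\|Ax\|_2+t}\ge f(x)$ for all $x\in\mathbb{R}^n$. A John function of a function $g:\mathbb{R}^n\to[0,\infty)$ is a function $s_0\mathbf{1}_{A_0B_2^n}$,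 where $(s_0,A_0)\in\mathbb{R}\times\mathcal{A}$ maximizes $s\,|\det A|$ among all $(s,A)\in\mathbb{R}\times\mathcal{A}$ with $s\le\|g\|_\infty$ and $s\mathbf{1}_{AB_2^n}\le g$. Then $f$ has exactly one Löwner function $L(f)$, its polar $f^\circ$ has exactly one John function $J(f^\circ)$, and $$(L(f))^\circ=J(f^\circ)$$ everywhere on $\mathbb{R}^n$. -/

import Mathlib

open MeasureTheory Set

/-- A function `ψ : ℝⁿ → ℝ ∪ {∞}` (it never takes the value `-∞`) is convex: its epigraph is a
convex set. -/
def IsConvexExtended {n : ℕ} (ψ : EuclideanSpace ℝ (Fin n) → EReal) : Prop :=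
  (∀ x, ψ x ≠ ⊥) ∧
    Convex ℝ {p : EuclideanSpace ℝ (Fin n) × ℝ | ψ p.1 ≤ (p.2 : EReal)}

/-- `f : ℝⁿ → ℝ` is log-concave: `f = e^{-ψ}` for a convex function `ψ : ℝⁿ → ℝ ∪ {∞}`, with
`e^{-∞} = 0`. -/
def IsLogConcave {n : ℕ} (f : EuclideanSpace ℝ (Fin n) → ℝ) : Prop :=
  ∃ ψ : EuclideanSpace ℝ (Fin n) → EReal,
    IsConvexExtended ψ ∧ ∀ x, f x = (EReal.exp (-ψ x)).toReal

/-- `f` is nondegenerate: the interior of its support is nonempty. -/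
def IsNondegenerate {n : ℕ} (f : EuclideanSpace ℝ (Fin n) → ℝ) : Prop :=
  (interior (Function.support f)).Nonempty

/-- The polar (dual) function `f°(y) = inf_{x ∈ supp f} e^{-⟨x, y⟩} / f(x)`. -/
noncomputable def polarFunction {n : ℕ} (f : EuclideanSpace ℝ (Fin n) → ℝ) :
    EuclideanSpace ℝ (Fin n) → ℝ :=
  fun y => ⨅ x : Function.support f,
    Real.exp (-(inner ℝ (x : EuclideanSpace ℝ (Fin n)) y)) / f x

/-- The ellipsoidal function `x ↦ e^{-‖A x‖₂ + t}`. -/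
noncomputable def lownerEllipsoidal {n : ℕ}
    (A : EuclideanSpace ℝ (Fin n) ≃ᵃ[ℝ] EuclideanSpace ℝ (Fin n)) (t : ℝ) :
    EuclideanSpace ℝ (Fin n) → ℝ :=
  fun x => Real.exp (-‖A x‖ + t)

/-- `g` is a Löwner function of `f`: it is an ellipsoidal function `e^{-‖A₀ x‖₂ + t₀}`, with `A₀` a
nonsingular affine map and `t₀` real, which lies above `f` and has the least integral among all
ellipsoidal functions of this form above `f`. -/
def IsLownerFunction {n : ℕ} (f g : EuclideanSpace ℝ (Fin n) → ℝ) : Prop :=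
  ∃ (A₀ : EuclideanSpace ℝ (Fin n) ≃ᵃ[ℝ] EuclideanSpace ℝ (Fin n)) (t₀ : ℝ),
    g = lownerEllipsoidal A₀ t₀ ∧
    (∀ x, f x ≤ lownerEllipsoidal A₀ t₀ x) ∧
    ∀ (A : EuclideanSpace ℝ (Fin n) ≃ᵃ[ℝ] EuclideanSpace ℝ (Fin n)) (t : ℝ),
      (∀ x, f x ≤ lownerEllipsoidal A t x) →
        ∫ x, lownerEllipsoidal A₀ t₀ x ≤ ∫ x, lownerEllipsoidal A t x

/-- The ellipsoidal function `s 𝟙_{A B}`, where `B` is the closed Euclidean unit ball. -/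
noncomputable def johnEllipsoidal {n : ℕ}
    (A : EuclideanSpace ℝ (Fin n) ≃ᵃ[ℝ] EuclideanSpace ℝ (Fin n)) (s : ℝ) :
    EuclideanSpace ℝ (Fin n) → ℝ :=
  (A '' Metric.closedBall 0 1).indicator (fun _ => s)

/-- `(s, A)` is admissible for the John problem of `f`: `s ≤ ‖f‖_∞` and `s 𝟙_{A B} ≤ f`. The
supremum norm is taken in `[0, ∞]`. -/
def JohnAdmissible {n : ℕ} (f : EuclideanSpace ℝ (Fin n) → ℝ)
    (A : EuclideanSpace ℝ (Fin n) ≃ᵃ[ℝ] EuclideanSpace ℝ (Fin n)) (s : ℝ) : Prop :=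
  ENNReal.ofReal s ≤ ⨆ x, ‖f x‖ₑ ∧ ∀ x, johnEllipsoidal A s x ≤ f x

/-- `h` is a John function of `f`: `h = s₀ 𝟙_{A₀ B}` where `(s₀, A₀)` maximizes `s |det A|` among
all admissible pairs of a real number `s` and a nonsingular affine map `A`. -/
def IsJohnFunction {n : ℕ} (f h : EuclideanSpace ℝ (Fin n) → ℝ) : Prop :=
  ∃ (A₀ : EuclideanSpace ℝ (Fin n) ≃ᵃ[ℝ] EuclideanSpace ℝ (Fin n)) (s₀ : ℝ),
    h = johnEllipsoidal A₀ s₀ ∧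
    JohnAdmissible f A₀ s₀ ∧
    ∀ (A : EuclideanSpace ℝ (Fin n) ≃ᵃ[ℝ] EuclideanSpace ℝ (Fin n)) (s : ℝ),
      JohnAdmissible f A s →
        s * |LinearMap.det
          (A.linear : EuclideanSpace ℝ (Fin n) →ₗ[ℝ] EuclideanSpace ℝ (Fin n))| ≤
        s₀ * |LinearMap.det
          (A₀.linear : EuclideanSpace ℝ (Fin n) →ₗ[ℝ] EuclideanSpace ℝ (Fin n))|

open Filter Topology Metric

variable {n : ℕ}

theorem IsLogConcave.nonneg {f : EuclideanSpace ℝ (Fin n) → ℝ} (hf : IsLogConcave f) (x) :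
    0 ≤ f x := by
  obtain ⟨ψ, -, h⟩ := hf
  rw [h]
  exact ENNReal.toReal_nonneg

/-- The logarithm of a log-concave function is concave on the support. -/
theorem IsLogConcave.concaveOn_log {f : EuclideanSpace ℝ (Fin n) → ℝ} (hf : IsLogConcave f) :
    ConcaveOn ℝ (Function.support f) (fun x => Real.log (f x)) := by
  obtain ⟨ψ, ⟨hbot, hconv⟩, h⟩ := hf
  have key : ∀ x, ∀ r : ℝ, ψ x = r → f x = Real.exp (-r) := by
    intro x r hr
    rw [h, hr, ← EReal.coe_neg, EReal.exp_coe, ENNReal.toReal_ofReal (Real.exp_pos _).le]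
  have hfin : ∀ x ∈ Function.support f, ψ x = ((-Real.log (f x) : ℝ) : EReal) := by
    intro x hx
    have hx' : ψ x ≠ ⊤ := by
      intro htop
      apply hx
      rw [h, htop]
      simp
    have hr := EReal.coe_toReal hx' (hbot x)
    rw [key x _ hr.symm, Real.log_exp, neg_neg, hr]
  have main : ∀ x ∈ Function.support f, ∀ y ∈ Function.support f, ∀ a b : ℝ, 0 ≤ a → 0 ≤ b →
      a + b = 1 → a • x + b • y ∈ Function.support f ∧
        a * Real.log (f x) + b * Real.log (f y) ≤ Real.log (f (a • x + b • y)) := by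
    intro x hx y hy a b ha hb hab
    have hxy := hconv (x := (x, -Real.log (f x))) (hfin x hx).le
      (y := (y, -Real.log (f y))) (hfin y hy).le ha hb hab
    have hle : ψ (a • x + b • y) ≤
        ((a * (-Real.log (f x)) + b * (-Real.log (f y)) : ℝ) : EReal) := hxy
    have htop : ψ (a • x + b • y) ≠ ⊤ := ne_top_of_le_ne_top (EReal.coe_ne_top _) hle
    have hr := EReal.coe_toReal htop (hbot (a • x + b • y))
    have hval := key _ _ hr.symm
    rw [← hr, EReal.coe_le_coe_iff] at hle
    refine ⟨?_, ?_⟩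
    · rw [Function.mem_support, hval]
      exact (Real.exp_pos _).ne'
    · rw [hval, Real.log_exp]
      linarith
  exact ⟨fun x hx y hy a b ha hb hab => (main x hx y hy a b ha hb hab).1,
    fun x hx y hy a b ha hb hab => (main x hx y hy a b ha hb hab).2⟩

section EvenLogConcave

variable {E : Type*} [NormedAddCommGroup E] [NormedSpace ℝ E]

/-- The support of an even log-concave function is a neighbourhood of the origin as soon as its
interior is nonempty. -/
theorem zero_mem_interior_support {f : E → ℝ}
    (hc : Convex ℝ (Function.support f)) (heven : ∀ x, f (-x) = f x)
    (hnd : (interior (Function.support f)).Nonempty) : 0 ∈ interior (Function.support f) := by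
  obtain ⟨x, hx⟩ := hnd
  have hneg : -x ∈ interior (Function.support f) := by
    have hs : -Function.support f = Function.support f := by
      ext y
      simp [heven]
    have h := (Homeomorph.neg E).preimage_interior (Function.support f)
    rw [show (Homeomorph.neg E) ⁻¹' Function.support f = Function.support f from hs] at h
    rw [← h]
    simpa using hx
  have := hc.interior hx hneg (a := 1 / 2) (b := 1 / 2) (by norm_num) (by norm_num) (by norm_num)
  simpa using this

theorem le_apply_zero_of_even {f : E → ℝ} (h0 : ∀ x, 0 ≤ f x)
    (hc : ConcaveOn ℝ (Function.support f) (fun x => Real.log (f x)))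
    (heven : ∀ x, f (-x) = f x) (x : E) : f x ≤ f 0 := by
  have ⟨hc1, hc2⟩ := hc
  by_cases hx : f x = 0
  · rw [hx]
    exact h0 0
  have hneg : -x ∈ Function.support f := by simpa [heven] using hx
  have hz : (1 / 2 : ℝ) • x + (1 / 2 : ℝ) • -x = 0 := by simp
  have h1 := hc1 (x := x) hx hneg (a := 1 / 2) (b := 1 / 2) (by norm_num) (by norm_num)
    (by norm_num)
  have h2 := hc2 (x := x) hx hneg (a := 1 / 2) (b := 1 / 2) (by norm_num) (by norm_num)
    (by norm_num)
  rw [hz] at h1 h2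
  simp only [heven, smul_eq_mul] at h2
  refine (Real.log_le_log_iff (lt_of_le_of_ne (h0 x) (Ne.symm hx))
    (lt_of_le_of_ne (h0 0) (Ne.symm h1))).1 ?_
  linarith

theorem exists_pos_le_on_ball [FiniteDimensional ℝ E] {f : E → ℝ} (h0 : ∀ x, 0 ≤ f x)
    (hc : ConcaveOn ℝ (Function.support f) (fun x => Real.log (f x)))
    (hz : 0 ∈ interior (Function.support f)) :
    ∃ r > 0, ∃ δ > 0, ∀ x ∈ closedBall (0 : E) r, δ ≤ f x := by
  have hcont : ContinuousAt (fun x => Real.log (f x)) 0 :=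
    hc.continuousOn_interior.continuousAt (isOpen_interior.mem_nhds hz)
  have h1 : ∀ᶠ x in 𝓝 (0 : E), Real.log (f 0) - 1 < Real.log (f x) :=
    hcont.eventually (lt_mem_nhds (by simp))
  have h2 : ∀ᶠ x in 𝓝 (0 : E), x ∈ Function.support f := mem_interior_iff_mem_nhds.1 hz
  obtain ⟨r, hr, hball⟩ := Metric.nhds_basis_closedBall.eventually_iff.1 (h1.and h2)
  refine ⟨r, hr, Real.exp (Real.log (f 0) - 1), Real.exp_pos _, fun x hx => ?_⟩
  obtain ⟨hlog, hne⟩ := hball hx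
  rw [← Real.exp_log (lt_of_le_of_ne (h0 x) (Ne.symm hne))]
  exact Real.exp_le_exp.2 hlog.le

/-- Superlevel sets of an integrable log-concave function which is positive around the origin are
bounded. -/
theorem exists_lt_of_norm_gt [FiniteDimensional ℝ E] [MeasurableSpace E] [BorelSpace E]
    (μ : Measure E) [μ.IsAddHaarMeasure] {f : E → ℝ} (h0 : ∀ x, 0 ≤ f x)
    (hc : ConcaveOn ℝ (Function.support f) (fun x => Real.log (f x))) (hint : Integrable f μ)
    {r δ : ℝ} (hr : 0 < r) (hδ : 0 < δ) (hball : ∀ x ∈ closedBall (0 : E) r, δ ≤ f x) :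
    ∃ R, ∀ x : E, R < ‖x‖ → f x < δ := by
  have ⟨hc1, hc2⟩ := hc
  have hanti : Antitone fun k : ℕ => (closedBall (0 : E) (k : ℝ))ᶜ := fun i j hij =>
    compl_subset_compl.2 (closedBall_subset_closedBall (by exact_mod_cast hij))
  have hlim := tendsto_setIntegral_of_antitone (μ := μ) (f := f)
    (fun k : ℕ => (isClosed_closedBall (x := (0 : E)) (ε := (k : ℝ))).measurableSet.compl) hanti
    ⟨0, hint.integrableOn⟩
  have hempty : ⋂ k : ℕ, (closedBall (0 : E) (k : ℝ))ᶜ = ∅ := by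
    rw [← compl_iUnion, iUnion_closedBall_nat, compl_univ]
  rw [hempty, Measure.restrict_empty, integral_zero_measure] at hlim
  have hvol : 0 < μ.real (ball (0 : E) (r / 2)) :=
    ENNReal.toReal_pos (measure_ball_pos μ _ (by positivity)).ne' measure_ball_lt_top.ne
  obtain ⟨k, hk⟩ := (hlim.eventually (gt_mem_nhds (mul_pos hδ hvol))).exists
  refine ⟨2 * k + r, fun x hx => ?_⟩
  by_contra! hxδ
  have hsub : ball ((1 / 2 : ℝ) • x) (r / 2) ⊆ (closedBall (0 : E) (k : ℝ))ᶜ := by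
    intro y hy
    rw [mem_ball, dist_eq_norm] at hy
    have h1 : ‖(1 / 2 : ℝ) • x‖ = ‖x‖ / 2 := by
      rw [norm_smul]; norm_num; ring
    have h2 : ‖(1 / 2 : ℝ) • x‖ ≤ ‖y‖ + ‖y - (1 / 2 : ℝ) • x‖ := by
      simpa using norm_sub_le y (y - (1 / 2 : ℝ) • x)
    simp only [mem_compl_iff, mem_closedBall, dist_zero_right, not_le]
    linarith
  have hge : ∀ y ∈ ball ((1 / 2 : ℝ) • x) (r / 2), δ ≤ f y := by
    intro y hy
    rw [mem_ball, dist_eq_norm] at hy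
    set z : E := (2 : ℝ) • (y - (1 / 2 : ℝ) • x) with hzdef
    have hz : z ∈ closedBall (0 : E) r := by
      rw [mem_closedBall, dist_zero_right, hzdef, norm_smul, Real.norm_ofNat]
      linarith
    have hyz : (1 / 2 : ℝ) • x + (1 / 2 : ℝ) • z = y := by
      rw [hzdef, smul_smul]; norm_num
    have hxs : x ∈ Function.support f := (hδ.trans_le hxδ).ne'
    have hzs : z ∈ Function.support f := (hδ.trans_le (hball z hz)).ne'
    have h1 := hc1 hxs hzs (a := 1 / 2) (b := 1 / 2) (by norm_num) (by norm_num) (by norm_num)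
    have h2 := hc2 hxs hzs (a := 1 / 2) (b := 1 / 2) (by norm_num) (by norm_num) (by norm_num)
    rw [hyz] at h1 h2
    simp only [smul_eq_mul] at h2
    have h3 := Real.log_le_log hδ hxδ
    have h4 := Real.log_le_log hδ (hball z hz)
    refine (Real.log_le_log_iff hδ (lt_of_le_of_ne (h0 y) (Ne.symm h1))).1 ?_
    linarith
  have hlow : δ * μ.real (ball (0 : E) (r / 2)) ≤
      ∫ y in (closedBall (0 : E) (k : ℝ))ᶜ, f y ∂μ := by
    calc δ * μ.real (ball (0 : E) (r / 2))
        = ∫ y in ball ((1 / 2 : ℝ) • x) (r / 2), δ ∂μ := by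
          rw [setIntegral_const, smul_eq_mul, mul_comm, Measure.real, Measure.real,
            Measure.addHaar_ball_center μ ((1 / 2 : ℝ) • x)]
      _ ≤ ∫ y in ball ((1 / 2 : ℝ) • x) (r / 2), f y ∂μ :=
          setIntegral_mono_on (integrableOn_const measure_ball_lt_top.ne) hint.integrableOn
            measurableSet_ball hge
      _ ≤ ∫ y in (closedBall (0 : E) (k : ℝ))ᶜ, f y ∂μ :=
          setIntegral_mono_set hint.integrableOn (ae_of_all _ h0) hsub.eventuallyLE
  linarith

/-- An even integrable log-concave function with support of nonempty interior decays
exponentially. -/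
theorem exists_le_exp_neg_norm [FiniteDimensional ℝ E] [MeasurableSpace E] [BorelSpace E]
    (μ : Measure E) [μ.IsAddHaarMeasure] {f : E → ℝ} (h0 : ∀ x, 0 ≤ f x)
    (hc : ConcaveOn ℝ (Function.support f) (fun x => Real.log (f x)))
    (heven : ∀ x, f (-x) = f x) (hint : Integrable f μ)
    (hz : 0 ∈ interior (Function.support f)) :
    ∃ c > 0, ∃ t : ℝ, ∀ x : E, f x ≤ Real.exp (-(c * ‖x‖) + t) := by
  have ⟨hc1, hc2⟩ := hc
  obtain ⟨r, hr, δ, hδ, hball⟩ := exists_pos_le_on_ball h0 hc hz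
  have hM : 0 < f 0 := lt_of_le_of_ne (h0 0) (Ne.symm (interior_subset hz))
  set M := Real.log (f 0) with hMdef
  set δ' := min δ (Real.exp (M - 1)) with hδ'
  have hδ'pos : 0 < δ' := lt_min hδ (Real.exp_pos _)
  obtain ⟨R, hR⟩ := exists_lt_of_norm_gt μ h0 hc hint hr hδ'pos
    (fun x hx => (min_le_left _ _).trans (hball x hx))
  set S := max R 0 + 1
  have hS : 0 < S := by positivity
  have hRS : R < S := (le_max_left R 0).trans_lt (lt_add_one _)
  refine ⟨S⁻¹, inv_pos.2 hS, M + 1, fun x => ?_⟩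
  by_cases hx0 : f x = 0
  · rw [hx0]
    exact (Real.exp_pos _).le
  have hxpos : 0 < f x := lt_of_le_of_ne (h0 x) (Ne.symm hx0)
  rw [← Real.log_le_iff_le_exp hxpos]
  rcases le_total ‖x‖ S with hxS | hxS
  · have h1 : S⁻¹ * ‖x‖ ≤ 1 := by
      rw [inv_mul_le_iff₀ hS]; linarith
    have h2 := Real.log_le_log hxpos (le_apply_zero_of_even h0 hc heven x)
    linarith
  · have hxn : 0 < ‖x‖ := hS.trans_le hxS
    set a := S / ‖x‖ with ha
    have ha0 : 0 < a := div_pos hS hxn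
    have ha1 : a ≤ 1 := (div_le_one hxn).2 hxS
    have h1 := hc1 (x := x) (y := 0) hx0 hM.ne' ha0.le (sub_nonneg.2 ha1) (by ring)
    have h2 := hc2 (x := x) (y := 0) hx0 hM.ne' ha0.le (sub_nonneg.2 ha1) (by ring)
    simp only [smul_zero, add_zero, smul_eq_mul] at h1 h2
    have hn : ‖a • x‖ = S := by
      rw [norm_smul, Real.norm_of_nonneg ha0.le, ha]
      field_simp
    have h3 := (hR (a • x) (hn ▸ hRS)).trans_le (min_le_right _ _)
    rw [← Real.log_lt_iff_lt_exp (lt_of_le_of_ne (h0 _) (Ne.symm h1))] at h3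
    have h4 : a * Real.log (f x) ≤ a * (M - S⁻¹ * ‖x‖) := by
      have : a * (S⁻¹ * ‖x‖) = 1 := by
        rw [ha]; field_simp
      rw [mul_sub, this]
      nlinarith
    have := le_of_mul_le_mul_left h4 ha0
    linarith

end EvenLogConcave

theorem OrthonormalBasis.norm_sq_eq_sum_repr {E ι : Type*} [NormedAddCommGroup E] [InnerProductSpace ℝ E]
    [Fintype ι] (b : OrthonormalBasis ι ℝ E) (z : E) : ‖z‖ ^ 2 = ∑ i, b.repr z i ^ 2 := by
  rw [← b.repr.norm_map, EuclideanSpace.norm_sq_eq]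
  simp

theorem LinearMap.repr_toLin_diagonal {E ι : Type*} [NormedAddCommGroup E]
    [InnerProductSpace ℝ E] [Fintype ι] [DecidableEq ι]
    (b : OrthonormalBasis ι ℝ E) (d : ι → ℝ) (z : E) (i : ι) :
    b.repr (Matrix.toLin b.toBasis b.toBasis (Matrix.diagonal d) z) i = d i * b.repr z i := by
  have h := congrFun (Matrix.repr_toLin b.toBasis b.toBasis (Matrix.diagonal d) z) i
  rwa [Matrix.mulVec_diagonal] at h

section InnerProductGeometry

variable {E : Type*} [NormedAddCommGroup E] [InnerProductSpace ℝ E] [FiniteDimensional ℝ E]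

theorem LinearMap.det_adjoint_real (T : E →ₗ[ℝ] E) :
    LinearMap.det (LinearMap.adjoint T) = LinearMap.det T := by
  have b := stdOrthonormalBasis ℝ E
  rw [← LinearMap.det_toMatrix b.toBasis, ← LinearMap.det_toMatrix b.toBasis,
    LinearMap.toMatrix_adjoint, Matrix.det_conjTranspose, star_trivial]

theorem LinearMap.norm_adjoint_apply_le_iff (T : E →ₗ[ℝ] E) (x : E) (c : ℝ) :
    ‖LinearMap.adjoint T x‖ ≤ c ↔ ∀ u ∈ closedBall (0 : E) 1, inner ℝ x (T u) ≤ c := by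
  constructor
  · intro h u hu
    rw [mem_closedBall, dist_zero_right] at hu
    rw [← LinearMap.adjoint_inner_left]
    calc inner ℝ (LinearMap.adjoint T x) u ≤ ‖LinearMap.adjoint T x‖ * ‖u‖ :=
          real_inner_le_norm _ _
      _ ≤ ‖LinearMap.adjoint T x‖ * 1 := by gcongr
      _ ≤ c := by linarith
  · intro h
    set y := LinearMap.adjoint T x with hy
    by_cases hy0 : y = 0
    · have := h 0 (by simp)
      simpa [hy0] using this
    · have hn : ‖y‖ ≠ 0 := norm_ne_zero_iff.2 hy0
      have := h (‖y‖⁻¹ • y) (by simp [norm_smul, hn])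
      rw [← LinearMap.adjoint_inner_left, ← hy, inner_smul_right, real_inner_self_eq_norm_sq] at this
      calc ‖y‖ = ‖y‖⁻¹ * ‖y‖ ^ 2 := by field_simp
        _ ≤ c := this

/-- A rank-one perturbation which increases the determinant. -/
theorem LinearMap.exists_abs_det_lt_of_ne_zero {T : E →ₗ[ℝ] E} (hT : LinearMap.det T ≠ 0) {a : E}
    (ha : a ≠ 0) :
    ∃ T' : E →ₗ[ℝ] E, (∀ x, ‖T' x‖ ≤ ‖T x‖ + |inner ℝ a x|) ∧
      |LinearMap.det T| < |LinearMap.det T'| := by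
  have hTa : 0 < ‖T a‖ := norm_pos_iff.2 fun h =>
    ha ((T.equivOfDetNeZero hT).injective (by simpa using h))
  refine ⟨T ∘ₗ LinearMap.transvection (innerₗ E a) (‖T a‖⁻¹ • a), fun x => ?_, ?_⟩
  · simp only [LinearMap.comp_apply, LinearMap.transvection.apply, map_add, map_smul,
      innerₗ_apply_apply]
    refine (norm_add_le _ _).trans ?_
    rw [norm_smul, norm_smul, norm_inv, norm_norm, inv_mul_cancel₀ hTa.ne', mul_one,
      Real.norm_eq_abs]
  · rw [LinearMap.det_comp, LinearMap.transvection.det, abs_mul]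
    have h1 : 0 < innerₗ E a (‖T a‖⁻¹ • a) := by
      have : 0 < ‖a‖ := norm_pos_iff.2 ha
      rw [map_smul, innerₗ_apply_apply, real_inner_self_eq_norm_sq, smul_eq_mul]
      positivity
    refine lt_mul_of_one_lt_right (abs_pos.2 hT) ?_
    rw [abs_of_pos] <;> linarith

/-- The norms `‖z‖` and `‖W z‖` have an ellipsoidal lower mean, whose determinant is at least the
geometric mean of the determinants. -/
theorem LinearMap.exists_ellipsoidal_mean (W : E →ₗ[ℝ] E) (hW : LinearMap.det W ≠ 0) :
    ∃ D : E →ₗ[ℝ] E, (∀ z, ‖D z‖ ≤ (‖z‖ + ‖W z‖) / 2) ∧ |LinearMap.det W| ≤ LinearMap.det D ^ 2 ∧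
      (LinearMap.det D ^ 2 ≤ |LinearMap.det W| → ∀ z, ‖W z‖ = ‖z‖) := by
  have hS := W.isSymmetric_adjoint_comp_self
  set b := hS.eigenvectorBasis rfl with hb
  set σ : Fin (Module.finrank ℝ E) → ℝ := fun i => W.singularValues i with hσ
  have hdetW : |LinearMap.det W| = ∏ i, σ i := by
    rw [← Real.norm_eq_abs, ← LinearMap.normDet_eq_norm_det,
      LinearMap.normDet_eq_prod_singularValues, ← Fin.prod_univ_eq_prod_range]
  have hσ0 : ∀ i, 0 < σ i := by
    intro i
    refine lt_of_le_of_ne (W.singularValues_nonneg i) fun h => ?_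
    have : |LinearMap.det W| = 0 := by
      rw [hdetW]
      exact Finset.prod_eq_zero (Finset.mem_univ i) h.symm
    exact hW (abs_eq_zero.1 this)
  have hWz : ∀ z, ‖W z‖ ^ 2 = ∑ i, (σ i * b.repr z i) ^ 2 := by
    intro z
    rw [← real_inner_self_eq_norm_sq, ← LinearMap.adjoint_inner_left, ← b.repr.inner_map_map,
      PiLp.inner_apply]
    refine Finset.sum_congr rfl fun i _ => ?_
    have h1 := hS.eigenvectorBasis_apply_self_apply rfl z i
    rw [LinearMap.comp_apply] at h1
    rw [hb, h1, ← W.sq_singularValues_fin rfl]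
    simp [hσ]
    ring
  set P := Matrix.toLin b.toBasis b.toBasis (Matrix.diagonal σ) with hP
  have hPz : ∀ z, ‖P z‖ = ‖W z‖ := by
    intro z
    rw [← sq_eq_sq₀ (norm_nonneg _) (norm_nonneg _), hWz, b.norm_sq_eq_sum_repr]
    simp only [hP, LinearMap.repr_toLin_diagonal]
  set D := Matrix.toLin b.toBasis b.toBasis (Matrix.diagonal fun i => (1 + σ i) / 2) with hD
  have hDz : ∀ z, D z = (1 / 2 : ℝ) • (z + P z) := by
    intro z
    apply b.repr.injective
    ext i
    simp only [hD, hP, LinearMap.repr_toLin_diagonal, map_smul, map_add, PiLp.smul_apply,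
      PiLp.add_apply, smul_eq_mul]
    ring
  have hdetD : LinearMap.det D ^ 2 = ∏ i, ((1 + σ i) / 2) ^ 2 := by
    rw [hD, LinearMap.det_toLin, Matrix.det_diagonal, Finset.prod_pow]
  have hle : ∀ i ∈ Finset.univ, σ i ≤ ((1 + σ i) / 2) ^ 2 := fun i _ => by
    nlinarith [sq_nonneg (σ i - 1)]
  refine ⟨D, fun z => ?_, ?_, fun h z => ?_⟩
  · rw [hDz, norm_smul, ← hPz z]
    have := norm_add_le z (P z)
    norm_num
    linarith
  · rw [hdetW, hdetD]
    exact Finset.prod_le_prod (fun i _ => (hσ0 i).le) hle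
  · have hone : ∀ i, σ i = 1 := by
      by_contra! hne
      obtain ⟨i, hi⟩ := hne
      rw [hdetW, hdetD] at h
      refine absurd h (not_le.2 (Finset.prod_lt_prod (fun i _ => hσ0 i) hle
        ⟨i, Finset.mem_univ i, ?_⟩))
      have := sq_pos_of_ne_zero (sub_ne_zero.2 hi)
      nlinarith
    rw [← sq_eq_sq₀ (norm_nonneg _) (norm_nonneg _), hWz, b.norm_sq_eq_sum_repr]
    simp [hone]

theorem ContinuousLinearMap.abs_det_le_norm_pow (T : E →L[ℝ] E) :
    |LinearMap.det (T : E →ₗ[ℝ] E)| ≤ ‖T‖ ^ Module.finrank ℝ E := by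
  borelize E
  have h : volume (T '' ball (0 : E) 1) ≤ volume (closedBall (0 : E) ‖T‖) := by
    refine measure_mono ?_
    rintro _ ⟨x, hx, rfl⟩
    rw [mem_ball, dist_zero_right] at hx
    rw [mem_closedBall, dist_zero_right]
    exact (T.le_opNorm x).trans (mul_le_of_le_one_right (norm_nonneg _) hx.le)
  rw [Measure.addHaar_image_continuousLinearMap, Measure.addHaar_closedBall _ _ (norm_nonneg _),
    ENNReal.mul_le_mul_iff_left (measure_ball_pos volume _ one_pos).ne' measure_ball_lt_top.ne,
    ENNReal.ofReal_le_ofReal_iff (by positivity)] at h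
  exact h

end InnerProductGeometry

section Extremal

variable {E : Type*} [NormedAddCommGroup E] [InnerProductSpace ℝ E]

/-- The centred ellipsoidal function `x ↦ e^{-‖T x‖ + t}` lies above `f`. -/
def IsEllipsoidalMajorant (f : E → ℝ) (T : E →ₗ[ℝ] E) (t : ℝ) : Prop :=
  ∀ x, f x ≤ Real.exp (-‖T x‖ + t)

/-- `(T, t)` maximizes `e^{-t} |det T|` among the centred ellipsoidal functions above `f`. -/
def IsOptimalMajorant (f : E → ℝ) (T : E →ₗ[ℝ] E) (t : ℝ) : Prop :=
  IsEllipsoidalMajorant f T t ∧ ∀ T' t', IsEllipsoidalMajorant f T' t' →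
    Real.exp (-t') * |LinearMap.det T'| ≤ Real.exp (-t) * |LinearMap.det T|

theorem IsOptimalMajorant.det_ne_zero {f : E → ℝ} {T : E →ₗ[ℝ] E} {t : ℝ}
    (h : IsOptimalMajorant f T t)
    (hex : ∃ T' t', IsEllipsoidalMajorant f T' t' ∧ LinearMap.det T' ≠ 0) :
    LinearMap.det T ≠ 0 := by
  obtain ⟨T', t', hT', hdet⟩ := hex
  intro h0
  have h1 := h.2 T' t' hT'
  have h2 : 0 < Real.exp (-t') * |LinearMap.det T'| :=
    mul_pos (Real.exp_pos _) (abs_pos.2 hdet)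
  rw [h0, abs_zero, mul_zero] at h1
  linarith

theorem IsEllipsoidalMajorant.norm_le {f : E → ℝ} {r δ t : ℝ} (hr : 0 < r) (hδ : 0 < δ)
    (hball : ∀ x ∈ closedBall (0 : E) r, δ ≤ f x) {T : E →L[ℝ] E}
    (h : IsEllipsoidalMajorant f (T : E →ₗ[ℝ] E) t) :
    0 ≤ t - Real.log δ ∧ ‖T‖ ≤ (t - Real.log δ) / r := by
  have key : ∀ x ∈ closedBall (0 : E) r, ‖T x‖ ≤ t - Real.log δ := by
    intro x hx
    have h1 := (hball x hx).trans (h x)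
    rw [← Real.log_le_iff_le_exp hδ] at h1
    simp only [ContinuousLinearMap.coe_coe] at h1
    linarith
  have h0 : 0 ≤ t - Real.log δ := by simpa using key 0 (by simp [hr.le])
  refine ⟨h0, T.opNorm_le_bound (div_nonneg h0 hr.le) fun x => ?_⟩
  by_cases hx : x = 0
  · simp [hx]
  have hn : 0 < ‖x‖ := norm_pos_iff.2 hx
  have h1 := key ((r / ‖x‖) • x) (by
    rw [mem_closedBall, dist_zero_right, norm_smul, Real.norm_of_nonneg (by positivity)]
    field_simp
    exact le_rfl)
  rw [map_smul, norm_smul, Real.norm_of_nonneg (by positivity)] at h1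
  calc ‖T x‖ = (r / ‖x‖ * ‖T x‖) * (‖x‖ / r) := by field_simp
    _ ≤ (t - Real.log δ) * (‖x‖ / r) := by gcongr
    _ = (t - Real.log δ) / r * ‖x‖ := by ring

variable [FiniteDimensional ℝ E]

theorem exists_isOptimalMajorant {f : E → ℝ} {r δ : ℝ} (hr : 0 < r) (hδ : 0 < δ)
    (hball : ∀ x ∈ closedBall (0 : E) r, δ ≤ f x)
    (hex : ∃ T t, IsEllipsoidalMajorant f T t ∧ LinearMap.det T ≠ 0) :
    ∃ T t, IsOptimalMajorant f T t := by
  obtain ⟨T₀, t₀, h₀, hdet₀⟩ := hex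
  set d := Module.finrank ℝ E with hd
  set F : (E →L[ℝ] E) × ℝ → ℝ := fun p => Real.exp (-p.2) * |p.1.det| with hF
  have hFcont : Continuous F :=
    (Real.continuous_exp.comp continuous_snd.neg).mul
      (ContinuousLinearMap.continuous_det.comp continuous_fst).abs
  set K : Set ((E →L[ℝ] E) × ℝ) :=
    {p | IsEllipsoidalMajorant f (p.1 : E →ₗ[ℝ] E) p.2} with hK
  have hKclosed : IsClosed K := by
    have : K = ⋂ x, {p : (E →L[ℝ] E) × ℝ | f x ≤ Real.exp (-‖p.1 x‖ + p.2)} := by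
      ext p
      simp [hK, IsEllipsoidalMajorant]
    rw [this]
    exact isClosed_iInter fun x => isClosed_le continuous_const (by fun_prop)
  set p₀ : (E →L[ℝ] E) × ℝ := (LinearMap.toContinuousLinearMap T₀, t₀) with hp₀
  have hp₀K : p₀ ∈ K := h₀
  have hv₀ : 0 < F p₀ := mul_pos (Real.exp_pos _) (abs_pos.2 hdet₀)
  set C : ℝ := Real.exp (-Real.log δ) / r ^ d with hC
  have hbound : ∀ p ∈ K, F p ≤
      C * ((p.2 - Real.log δ) ^ d * Real.exp (-(p.2 - Real.log δ))) := by
    intro p hp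
    obtain ⟨h1, h2⟩ := IsEllipsoidalMajorant.norm_le hr hδ hball hp
    have h3 : |p.1.det| ≤ ((p.2 - Real.log δ) / r) ^ d :=
      (ContinuousLinearMap.abs_det_le_norm_pow p.1).trans (by gcongr)
    calc F p ≤ Real.exp (-p.2) * ((p.2 - Real.log δ) / r) ^ d := by
          simp only [hF]; gcongr
      _ = C * ((p.2 - Real.log δ) ^ d * Real.exp (-(p.2 - Real.log δ))) := by
          rw [hC, show -p.2 = -Real.log δ + -(p.2 - Real.log δ) by ring, Real.exp_add, div_pow]
          ring
  have hlim : Tendsto (fun u : ℝ => C * (u ^ d * Real.exp (-u))) atTop (𝓝 0) := by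
    simpa using (Real.tendsto_pow_mul_exp_neg_atTop_nhds_zero d).const_mul C
  obtain ⟨U, hU⟩ := eventually_atTop.1 (hlim.eventually (gt_mem_nhds hv₀))
  have hlarge : ∀ p ∈ K, F p₀ ≤ F p → p.2 - Real.log δ ≤ U := by
    intro p hp hle
    by_contra! hlt
    exact absurd ((hbound p hp).trans_lt (hU _ hlt.le)) (not_lt.2 hle)
  set B : Set ((E →L[ℝ] E) × ℝ) :=
    closedBall 0 (U / r) ×ˢ Icc (Real.log δ) (Real.log δ + U) with hB
  have hBcompact : IsCompact (B ∩ K) :=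
    ((isCompact_closedBall _ _).prod isCompact_Icc).inter_right hKclosed
  have hmem : ∀ p ∈ K, F p₀ ≤ F p → p ∈ B ∩ K := by
    intro p hp hle
    obtain ⟨h1, h2⟩ := IsEllipsoidalMajorant.norm_le hr hδ hball hp
    have h3 := hlarge p hp hle
    refine ⟨⟨?_, ?_, ?_⟩, hp⟩
    · rw [mem_closedBall, dist_zero_right]
      exact h2.trans (by gcongr)
    · linarith
    · linarith
  obtain ⟨p, hpmem, hpmax⟩ := hBcompact.exists_isMaxOn ⟨p₀, hmem p₀ hp₀K le_rfl⟩
    hFcont.continuousOn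
  refine ⟨p.1, p.2, hpmem.2, fun T' t' h' => ?_⟩
  have hp' : ((LinearMap.toContinuousLinearMap T', t') : (E →L[ℝ] E) × ℝ) ∈ K := h'
  rcases le_total (F p₀) (F (LinearMap.toContinuousLinearMap T', t')) with hle | hle
  · exact hpmax (hmem _ hp' hle)
  · exact le_trans hle (hpmax (hmem p₀ hp₀K le_rfl))

theorem IsOptimalMajorant.unique {f : E → ℝ} {T₁ T₂ : E →ₗ[ℝ] E} {t₁ t₂ : ℝ}
    (h₁ : IsOptimalMajorant f T₁ t₁) (h₂ : IsOptimalMajorant f T₂ t₂)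
    (hd₁ : LinearMap.det T₁ ≠ 0) (hd₂ : LinearMap.det T₂ ≠ 0) :
    t₁ = t₂ ∧ ∀ x, ‖T₁ x‖ = ‖T₂ x‖ := by
  set e := T₁.equivOfDetNeZero hd₁ with he
  have heT : ∀ x, e.symm (T₁ x) = x := fun x => e.symm_apply_apply x
  set W : E →ₗ[ℝ] E := T₂ ∘ₗ (e.symm : E →ₗ[ℝ] E) with hWdef
  have hWT : W ∘ₗ T₁ = T₂ := by
    ext x
    simp [hWdef, heT]
  have hdet : LinearMap.det W * LinearMap.det T₁ = LinearMap.det T₂ := by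
    rw [← LinearMap.det_comp, hWT]
  have hdW : LinearMap.det W ≠ 0 := fun h => hd₂ (by rw [← hdet, h, zero_mul])
  obtain ⟨D, hD, -, hDeq⟩ := LinearMap.exists_ellipsoidal_mean W hdW
  have hmaj : IsEllipsoidalMajorant f (D ∘ₗ T₁) ((t₁ + t₂) / 2) := by
    intro x
    have hDx : ‖D (T₁ x)‖ ≤ (‖T₁ x‖ + ‖T₂ x‖) / 2 := by
      have := hD (T₁ x)
      rwa [← LinearMap.comp_apply W, hWT] at this
    rcases le_or_gt (-‖T₁ x‖ + t₁) (-‖T₂ x‖ + t₂) with hle | hle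
    · refine (h₁.1 x).trans (Real.exp_le_exp.2 ?_)
      rw [LinearMap.comp_apply]
      linarith
    · refine (h₂.1 x).trans (Real.exp_le_exp.2 ?_)
      rw [LinearMap.comp_apply]
      linarith
  have hv₁ := h₁.2 _ _ hmaj
  have hv₂ := h₂.2 _ _ hmaj
  have h12 := le_antisymm (h₂.2 _ _ h₁.1) (h₁.2 _ _ h₂.1)
  rw [LinearMap.det_comp, abs_mul] at hv₁ hv₂
  rw [← hdet, abs_mul] at h12 hv₂
  have ha₁ : 0 < |LinearMap.det T₁| := abs_pos.2 hd₁
  have hexp : Real.exp (-((t₁ + t₂) / 2)) ^ 2 = Real.exp (-t₁) * Real.exp (-t₂) := by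
    rw [sq, ← Real.exp_add, ← Real.exp_add]
    ring_nf
  have hnorm : ∀ z, ‖W z‖ = ‖z‖ := by
    apply hDeq
    have hprod := mul_le_mul hv₁ hv₂ (by positivity) (by positivity)
    have hl : Real.exp (-((t₁ + t₂) / 2)) * (|LinearMap.det D| * |LinearMap.det T₁|) *
        (Real.exp (-((t₁ + t₂) / 2)) * (|LinearMap.det D| * |LinearMap.det T₁|)) =
        (Real.exp (-t₁) * Real.exp (-t₂) * |LinearMap.det T₁| ^ 2) * LinearMap.det D ^ 2 := by
      rw [← hexp, ← sq_abs (LinearMap.det D)]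
      ring
    have hr : Real.exp (-t₁) * |LinearMap.det T₁| *
        (Real.exp (-t₂) * (|LinearMap.det W| * |LinearMap.det T₁|)) =
        (Real.exp (-t₁) * Real.exp (-t₂) * |LinearMap.det T₁| ^ 2) * |LinearMap.det W| := by
      ring
    rw [hl, hr] at hprod
    exact le_of_mul_le_mul_left hprod (by positivity)
  have hdW1 : |LinearMap.det W| = 1 := by
    rw [← Real.norm_eq_abs, ← LinearMap.normDet_eq_norm_det]
    exact LinearIsometry.normDet_eq_one ⟨W, hnorm⟩
  constructor
  · rw [hdW1, one_mul] at h12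
    have := mul_right_cancel₀ ha₁.ne' h12
    have := Real.exp_injective this
    linarith
  · intro x
    rw [← hnorm (T₁ x), ← LinearMap.comp_apply, hWT]

end Extremal

section Loewner

theorem integrable_exp_neg_norm {E : Type*} [NormedAddCommGroup E] [NormedSpace ℝ E]
    [FiniteDimensional ℝ E] [MeasurableSpace E] [BorelSpace E] (μ : Measure E)
    [μ.IsAddHaarMeasure] : Integrable (fun x : E => Real.exp (-‖x‖)) μ := by
  set m : ℕ := Module.finrank ℝ E + 1 with hm
  have h := integrable_one_add_norm (E := E) (μ := μ) (r := (m : ℝ)) (by rw [hm]; push_cast; linarith)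
  refine (h.const_mul ((m.factorial : ℝ) * Real.exp 1)).mono'
    (by fun_prop) (ae_of_all _ fun x => ?_)
  have h1 : 0 < 1 + ‖x‖ := by positivity
  have h2 := Real.pow_div_factorial_le_exp (1 + ‖x‖) h1.le m
  rw [Real.norm_of_nonneg (Real.exp_pos _).le, Real.rpow_neg h1.le, Real.rpow_natCast, Real.exp_neg]
  rw [div_le_iff₀ (by positivity), Real.exp_add] at h2
  rw [← div_eq_mul_inv, inv_eq_one_div, div_le_div_iff₀ (Real.exp_pos _) (by positivity)]
  linarith

theorem integral_exp_neg_norm_pos {E : Type*} [NormedAddCommGroup E] [NormedSpace ℝ E]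
    [FiniteDimensional ℝ E] [MeasurableSpace E] [BorelSpace E] (μ : Measure E)
    [μ.IsAddHaarMeasure] : 0 < ∫ x : E, Real.exp (-‖x‖) ∂μ :=
  integral_exp_pos (integrable_exp_neg_norm μ)

theorem integral_comp_linearMap_add {E F : Type*} [NormedAddCommGroup E] [NormedSpace ℝ E]
    [FiniteDimensional ℝ E] [MeasurableSpace E] [BorelSpace E] [NormedAddCommGroup F]
    [NormedSpace ℝ F] (μ : Measure E)
    [μ.IsAddHaarMeasure] (g : E → F) {T : E →ₗ[ℝ] E} (hT : LinearMap.det T ≠ 0) (a : E) :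
    ∫ x, g (T x + a) ∂μ = |LinearMap.det T|⁻¹ • ∫ x, g x ∂μ := by
  have hemb : MeasurableEmbedding T :=
    (T.equivOfDetNeZero hT).toContinuousLinearEquiv.toHomeomorph.measurableEmbedding
  rw [← hemb.integral_map (fun y => g (y + a)), Measure.map_linearMap_addHaar_eq_smul_addHaar μ hT,
    integral_smul_measure, integral_add_right_eq_self, abs_inv,
    ENNReal.toReal_ofReal (by positivity)]

theorem exists_sin_cos_one_lt_exp_mul_pow {α : ℝ} (hα : 0 < α) (d : ℕ) :
    ∃ s c : ℝ, 0 ≤ c ∧ c ^ 2 + s ^ 2 = 1 ∧ 1 < Real.exp (s * α) * c ^ d := by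
  set s : ℝ := α / ((d + 1) * (1 + α)) with hs
  have hs0 : 0 < s := by positivity
  have hd : (0 : ℝ) ≤ d := Nat.cast_nonneg d
  have hsα : s * (d + 1) * (1 + α) = α := by rw [hs]; field_simp
  have h1 : s * (d + 1) < 1 := by
    by_contra! h
    nlinarith
  have h2 : s * (d + 1) ≤ α := by nlinarith [mul_pos (mul_pos hs0 (by positivity : (0:ℝ) < d + 1)) hα]
  have hs1 : s < 1 := by nlinarith
  have hc : 0 ≤ 1 - s ^ 2 := by nlinarith
  refine ⟨s, √(1 - s ^ 2), Real.sqrt_nonneg _, by rw [Real.sq_sqrt hc]; ring, ?_⟩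
  have hlt : 1 < (Real.exp (s * α) * √(1 - s ^ 2) ^ d) ^ 2 := by
    rw [mul_pow, ← pow_mul, mul_comm d 2, pow_mul, Real.sq_sqrt hc]
    have hb : 1 - d * s ^ 2 ≤ (1 - s ^ 2) ^ d := by
      have := one_add_mul_le_pow (a := -s ^ 2) (by nlinarith) d
      calc 1 - d * s ^ 2 = 1 + d * (-s ^ 2) := by ring
        _ ≤ (1 + -s ^ 2) ^ d := this
        _ = (1 - s ^ 2) ^ d := by ring
    have he : 1 + 2 * (s * α) ≤ Real.exp (s * α) ^ 2 := by
      rw [← Real.exp_nat_mul]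
      have := Real.add_one_le_exp (((2 : ℕ) : ℝ) * (s * α))
      push_cast at this ⊢
      linarith
    have hds : d * s < 1 - s := by linarith
    have hq : 4 * (d * s ^ 2) ≤ 1 := by
      have : d * s ^ 2 ≤ (1 - s) * s := by nlinarith
      nlinarith [sq_nonneg (2 * s - 1)]
    have hlow : (1 + 2 * (s * α)) * (1 - d * s ^ 2) ≤
        Real.exp (s * α) ^ 2 * (1 - s ^ 2) ^ d :=
      mul_le_mul he hb (by nlinarith) (by positivity)
    have hgt : 1 < (1 + 2 * (s * α)) * (1 - d * s ^ 2) := by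
      have e1 : s * (d * s) < s * α := by
        apply mul_lt_mul_of_pos_left _ hs0
        linarith
      have e2 : s * α * (4 * (d * s ^ 2)) ≤ s * α * 1 :=
        mul_le_mul_of_nonneg_left hq (by positivity)
      nlinarith [mul_pos hs0 hα]
    linarith
  by_contra! h
  have := pow_le_one₀ (n := 2) (by positivity) h
  linarith

theorem IsEllipsoidalMajorant.of_translate {E : Type*} [NormedAddCommGroup E]
    [InnerProductSpace ℝ E] {f : E → ℝ} (heven : ∀ x, f (-x) = f x) {T : E →ₗ[ℝ] E} {a : E} {t : ℝ}
    (h : ∀ x, f x ≤ Real.exp (-‖T x + a‖ + t)) {s c : ℝ} (hc : 0 ≤ c) (hcs : c ^ 2 + s ^ 2 = 1) :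
    IsEllipsoidalMajorant f (c • T) (t - s * ‖a‖) := by
  intro x
  have h1 := h x
  have h2 := h (-x)
  rw [heven, map_neg, ← norm_neg, neg_add, neg_neg, ← sub_eq_add_neg] at h2
  have hpar := parallelogram_law_with_norm ℝ (T x) a
  have hcauchy : (c * ‖T x‖ + s * ‖a‖) ^ 2 ≤ ‖T x‖ ^ 2 + ‖a‖ ^ 2 := by
    have := sq_nonneg (s * ‖T x‖ - c * ‖a‖)
    calc (c * ‖T x‖ + s * ‖a‖) ^ 2
        ≤ (c * ‖T x‖ + s * ‖a‖) ^ 2 + (s * ‖T x‖ - c * ‖a‖) ^ 2 := by linarith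
      _ = (c ^ 2 + s ^ 2) * (‖T x‖ ^ 2 + ‖a‖ ^ 2) := by ring
      _ = ‖T x‖ ^ 2 + ‖a‖ ^ 2 := by rw [hcs, one_mul]
  rw [LinearMap.smul_apply, norm_smul, Real.norm_of_nonneg hc]
  by_cases hle : c * ‖T x‖ + s * ‖a‖ ≤ ‖T x + a‖
  · exact h1.trans (Real.exp_le_exp.2 (by linarith))
  · refine h2.trans (Real.exp_le_exp.2 ?_)
    push Not at hle
    have h3 : ‖T x + a‖ ^ 2 < (c * ‖T x‖ + s * ‖a‖) ^ 2 := by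
      gcongr
    have h4 : c * ‖T x‖ + s * ‖a‖ ≤ ‖T x - a‖ := by
      refine le_of_sq_le_sq ?_ (norm_nonneg _)
      nlinarith
    linarith

variable {n : ℕ}

theorem affineEquiv_apply_eq {E : Type*} [AddCommGroup E] [Module ℝ E] (A : E ≃ᵃ[ℝ] E) (x : E) :
    A x = (A.linear : E →ₗ[ℝ] E) x + A 0 := by
  simpa using A.map_vadd 0 x

theorem det_affineEquiv_linear_ne_zero {E : Type*} [AddCommGroup E] [Module ℝ E]
    (A : E ≃ᵃ[ℝ] E) : LinearMap.det (A.linear : E →ₗ[ℝ] E) ≠ 0 :=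
  A.linear.isUnit_det'.ne_zero

theorem exists_affineEquiv_eq {E : Type*} [AddCommGroup E] [Module ℝ E] {T : E →ₗ[ℝ] E}
    [FiniteDimensional ℝ E] (hT : LinearMap.det T ≠ 0) :
    ∃ A : E ≃ᵃ[ℝ] E, (A.linear : E →ₗ[ℝ] E) = T ∧ ∀ x, A x = T x :=
  ⟨(T.equivOfDetNeZero hT).toAffineEquiv, rfl, fun _ => rfl⟩

theorem integral_lownerEllipsoidal
    (A : EuclideanSpace ℝ (Fin n) ≃ᵃ[ℝ] EuclideanSpace ℝ (Fin n)) (t : ℝ) :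
    ∫ x, lownerEllipsoidal A t x = (Real.exp (-t) *
      |LinearMap.det (A.linear : EuclideanSpace ℝ (Fin n) →ₗ[ℝ] EuclideanSpace ℝ (Fin n))|)⁻¹ *
      ∫ x : EuclideanSpace ℝ (Fin n), Real.exp (-‖x‖) := by
  have h := integral_comp_linearMap_add (volume : Measure (EuclideanSpace ℝ (Fin n)))
    (fun y => Real.exp (-‖y‖)) (det_affineEquiv_linear_ne_zero A) (A 0)
  simp only [← affineEquiv_apply_eq, smul_eq_mul] at h
  simp only [lownerEllipsoidal, Real.exp_add, integral_mul_const]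
  rw [h, Real.exp_neg t, mul_inv, inv_inv]
  ring

theorem integral_lownerEllipsoidal_le_iff
    (A A' : EuclideanSpace ℝ (Fin n) ≃ᵃ[ℝ] EuclideanSpace ℝ (Fin n)) (t t' : ℝ) :
    ∫ x, lownerEllipsoidal A t x ≤ ∫ x, lownerEllipsoidal A' t' x ↔
      Real.exp (-t') * |LinearMap.det
        (A'.linear : EuclideanSpace ℝ (Fin n) →ₗ[ℝ] EuclideanSpace ℝ (Fin n))| ≤
      Real.exp (-t) * |LinearMap.det
        (A.linear : EuclideanSpace ℝ (Fin n) →ₗ[ℝ] EuclideanSpace ℝ (Fin n))| := by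
  have h := abs_pos.2 (det_affineEquiv_linear_ne_zero A)
  have h' := abs_pos.2 (det_affineEquiv_linear_ne_zero A')
  rw [integral_lownerEllipsoidal, integral_lownerEllipsoidal,
    mul_le_mul_iff_left₀ (integral_exp_neg_norm_pos volume), inv_le_inv₀ (by positivity)
    (by positivity)]

/-- The Löwner functions are the functions given by optimal centred majorants. -/
theorem isLownerFunction_iff {f g : EuclideanSpace ℝ (Fin n) → ℝ} (heven : ∀ x, f (-x) = f x)
    (hex : ∃ T t, IsEllipsoidalMajorant f T t ∧ LinearMap.det T ≠ 0) :
    IsLownerFunction f g ↔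
      ∃ T t, IsOptimalMajorant f T t ∧ g = fun x => Real.exp (-‖T x‖ + t) := by
  have hmaj : ∀ (A : EuclideanSpace ℝ (Fin n) ≃ᵃ[ℝ] EuclideanSpace ℝ (Fin n)) (t : ℝ),
      (∀ x, f x ≤ lownerEllipsoidal A t x) →
      ∀ x, f x ≤ Real.exp (-‖(A.linear : EuclideanSpace ℝ (Fin n) →ₗ[ℝ] _) x + A 0‖ + t) := by
    intro A t h x
    rw [← affineEquiv_apply_eq]
    exact h x
  constructor
  · rintro ⟨A, t, rfl, hA, hmin⟩
    set T := A.linear.toLinearMap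
    have hdet : LinearMap.det T ≠ 0 := det_affineEquiv_linear_ne_zero A
    have hopt : IsOptimalMajorant f T t := by
      constructor
      · simpa using IsEllipsoidalMajorant.of_translate heven (hmaj A t hA) (s := 0) (c := 1)
          zero_le_one (by norm_num)
      · intro T' t' h'
        by_cases hdet' : LinearMap.det T' = 0
        · rw [hdet', abs_zero, mul_zero]
          positivity
        · obtain ⟨A', hA', hA'x⟩ := exists_affineEquiv_eq hdet'
          have := hmin A' t' fun x => by
            rw [lownerEllipsoidal, hA'x]
            exact h' x
          rwa [integral_lownerEllipsoidal_le_iff, hA'] at this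
    refine ⟨T, t, hopt, ?_⟩
    have hzero : A 0 = 0 := by
      by_contra hne
      obtain ⟨s, c, hc, hcs, hlt⟩ := exists_sin_cos_one_lt_exp_mul_pow (norm_pos_iff.2 hne)
        (Module.finrank ℝ (EuclideanSpace ℝ (Fin n)))
      have := hopt.2 _ _ (IsEllipsoidalMajorant.of_translate heven (hmaj A t hA) hc hcs)
      rw [LinearMap.det_smul, abs_mul, abs_of_nonneg (pow_nonneg hc _), neg_sub, sub_eq_add_neg,
        Real.exp_add] at this
      have hpos : 0 < Real.exp (-t) * |LinearMap.det T| :=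
        mul_pos (Real.exp_pos _) (abs_pos.2 hdet)
      nlinarith [mul_lt_mul_of_pos_right hlt hpos]
    ext x
    rw [lownerEllipsoidal, affineEquiv_apply_eq, hzero, add_zero]
  · rintro ⟨T, t, hopt, rfl⟩
    obtain ⟨A, hA, hAx⟩ := exists_affineEquiv_eq (hopt.det_ne_zero hex)
    refine ⟨A, t, ?_, fun x => ?_, fun A' t' h' => ?_⟩
    · ext x
      rw [lownerEllipsoidal, hAx]
    · rw [lownerEllipsoidal, hAx]
      exact hopt.1 x
    · rw [integral_lownerEllipsoidal_le_iff, hA]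
      apply hopt.2
      simpa using IsEllipsoidalMajorant.of_translate heven (hmaj A' t' h') (s := 0) (c := 1)
        zero_le_one (by norm_num)

end Loewner

section John

variable {n : ℕ}

theorem le_polarFunction_iff {f : EuclideanSpace ℝ (Fin n) → ℝ} (h0 : ∀ x, 0 ≤ f x)
    (hne : (Function.support f).Nonempty) {s : ℝ} {y : EuclideanSpace ℝ (Fin n)} :
    s ≤ polarFunction f y ↔ ∀ x, s * f x ≤ Real.exp (-(inner ℝ x y)) := by
  have : Nonempty (Function.support f) := hne.to_subtype
  have hbdd : BddBelow (range fun x : Function.support f =>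
      Real.exp (-(inner ℝ (x : EuclideanSpace ℝ (Fin n)) y)) / f x) :=
    ⟨0, by rintro _ ⟨x, rfl⟩; exact div_nonneg (Real.exp_pos _).le (h0 _)⟩
  rw [polarFunction, le_ciInf_iff hbdd]
  constructor
  · intro h x
    by_cases hx : f x = 0
    · rw [hx, mul_zero]
      positivity
    · rw [← le_div_iff₀ (lt_of_le_of_ne (h0 x) (Ne.symm hx))]
      exact h ⟨x, hx⟩
  · intro h x
    rw [le_div_iff₀ (lt_of_le_of_ne (h0 x) (Ne.symm x.2))]
    exact h x

theorem polarFunction_nonneg {f : EuclideanSpace ℝ (Fin n) → ℝ} (h0 : ∀ x, 0 ≤ f x)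
    (y : EuclideanSpace ℝ (Fin n)) : 0 ≤ polarFunction f y :=
  Real.iInf_nonneg fun _ => div_nonneg (Real.exp_pos _).le (h0 _)

/-- For positive heights the bound by the supremum norm in the John problem is automatic. -/
theorem johnAdmissible_iff {g : EuclideanSpace ℝ (Fin n) → ℝ} (h0 : ∀ y, 0 ≤ g y)
    {A : EuclideanSpace ℝ (Fin n) ≃ᵃ[ℝ] EuclideanSpace ℝ (Fin n)} {s : ℝ} :
    JohnAdmissible g A s ↔ ∀ u ∈ closedBall (0 : EuclideanSpace ℝ (Fin n)) 1, s ≤ g (A u) := by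
  constructor
  · rintro ⟨-, h⟩ u hu
    have := h (A u)
    rwa [johnEllipsoidal, indicator_of_mem (mem_image_of_mem A hu)] at this
  · intro h
    constructor
    · refine le_trans ?_ (le_iSup (fun x => ‖g x‖ₑ) (A 0))
      rw [Real.enorm_eq_ofReal_abs]
      exact ENNReal.ofReal_le_ofReal ((h 0 (by simp)).trans (le_abs_self _))
    · intro y
      by_cases hy : y ∈ A '' closedBall 0 1
      · rw [johnEllipsoidal, indicator_of_mem hy]
        obtain ⟨u, hu, rfl⟩ := hy
        exact h u hu
      · rw [johnEllipsoidal, indicator_of_notMem hy]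
        exact h0 y

theorem JohnAdmissible.le_exp {f : EuclideanSpace ℝ (Fin n) → ℝ} (h0 : ∀ x, 0 ≤ f x)
    (hne : (Function.support f).Nonempty) (heven : ∀ x, f (-x) = f x)
    {A : EuclideanSpace ℝ (Fin n) ≃ᵃ[ℝ] EuclideanSpace ℝ (Fin n)} {s : ℝ} (hs : 0 < s)
    (h : JohnAdmissible (polarFunction f) A s) (x : EuclideanSpace ℝ (Fin n)) :
    f x ≤ Real.exp (-(‖LinearMap.adjoint A.linear.toLinearMap x‖ + |inner ℝ (A 0) x|) +
      -Real.log s) := by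
  rw [johnAdmissible_iff (polarFunction_nonneg h0)] at h
  by_cases hx : f x = 0
  · rw [hx]
    positivity
  have key : ∀ z, f z = f x → ‖LinearMap.adjoint A.linear.toLinearMap z‖ ≤
      -Real.log s - Real.log (f x) - inner ℝ (A 0) z := by
    intro z hz
    rw [LinearMap.norm_adjoint_apply_le_iff]
    intro u hu
    have h1 := (le_polarFunction_iff h0 hne).1 (h u hu) z
    have hfz : 0 < f z := lt_of_le_of_ne (h0 z) (Ne.symm (hz ▸ hx))
    rw [← Real.log_le_iff_le_exp (mul_pos hs hfz), Real.log_mul hs.ne' hfz.ne', hz,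
      affineEquiv_apply_eq, inner_add_right] at h1
    rw [real_inner_comm z (A 0)]
    linarith
  have h1 := key x rfl
  have h2 := key (-x) (heven x)
  rw [map_neg, norm_neg, inner_neg_right] at h2
  rw [← Real.log_le_iff_le_exp (lt_of_le_of_ne (h0 x) (Ne.symm hx))]
  rcases abs_cases (inner ℝ (A 0) x) with ⟨h3, -⟩ | ⟨h3, -⟩ <;> rw [h3] <;> linarith

theorem IsEllipsoidalMajorant.johnAdmissible {f : EuclideanSpace ℝ (Fin n) → ℝ}
    (h0 : ∀ x, 0 ≤ f x) (hne : (Function.support f).Nonempty)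
    {T : EuclideanSpace ℝ (Fin n) →ₗ[ℝ] EuclideanSpace ℝ (Fin n)} {t : ℝ}
    (h : IsEllipsoidalMajorant f T t)
    {A : EuclideanSpace ℝ (Fin n) ≃ᵃ[ℝ] EuclideanSpace ℝ (Fin n)}
    (hA : ∀ u, A u = LinearMap.adjoint T u) :
    JohnAdmissible (polarFunction f) A (Real.exp (-t)) := by
  rw [johnAdmissible_iff (polarFunction_nonneg h0)]
  intro u hu
  rw [le_polarFunction_iff h0 hne]
  intro x
  have h1 : inner ℝ x (A u) ≤ ‖T x‖ := by
    rw [mem_closedBall, dist_zero_right] at hu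
    rw [hA, LinearMap.adjoint_inner_right]
    exact (real_inner_le_norm _ _).trans (mul_le_of_le_one_right (norm_nonneg _) hu)
  calc Real.exp (-t) * f x ≤ Real.exp (-t) * Real.exp (-‖T x‖ + t) := by
        gcongr
        exact h x
    _ = Real.exp (-‖T x‖) := by rw [← Real.exp_add]; ring_nf
    _ ≤ Real.exp (-(inner ℝ x (A u))) := Real.exp_le_exp.2 (by linarith)

/-- The polar of a centred ellipsoidal function `e^{-‖T x‖ + t}` is a multiple of the indicator of
an ellipsoid. -/
theorem polarFunction_exp_neg_norm
    {T : EuclideanSpace ℝ (Fin n) →ₗ[ℝ] EuclideanSpace ℝ (Fin n)} (hT : LinearMap.det T ≠ 0)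
    (t : ℝ) {A : EuclideanSpace ℝ (Fin n) ≃ᵃ[ℝ] EuclideanSpace ℝ (Fin n)}
    (hA : ∀ u, A u = LinearMap.adjoint T u) :
    polarFunction (fun x => Real.exp (-‖T x‖ + t)) = johnEllipsoidal A (Real.exp (-t)) := by
  set g : EuclideanSpace ℝ (Fin n) → ℝ := fun x => Real.exp (-‖T x‖ + t) with hg
  have hpos : ∀ x, 0 < g x := fun x => Real.exp_pos _
  have hle : ∀ x y, polarFunction g y ≤ Real.exp (-(inner ℝ x y)) / g x := by
    intro x y
    rw [le_div_iff₀ (hpos x)]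
    exact (le_polarFunction_iff (fun x => (hpos x).le) ⟨0, (hpos 0).ne'⟩).1 le_rfl x
  have hadm : JohnAdmissible (polarFunction g) A (Real.exp (-t)) :=
    IsEllipsoidalMajorant.johnAdmissible (fun x => (hpos x).le) ⟨0, (hpos 0).ne'⟩
      (fun _ => le_rfl) hA
  ext y
  refine le_antisymm ?_ (hadm.2 y)
  by_cases hy : y ∈ A '' closedBall 0 1
  · rw [johnEllipsoidal, indicator_of_mem hy]
    refine (hle 0 y).trans (le_of_eq ?_)
    simp [hg, Real.exp_neg]
  · rw [johnEllipsoidal, indicator_of_notMem hy]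
    obtain ⟨u, rfl⟩ := A.surjective y
    have hu : 1 < ‖u‖ := by
      by_contra! h
      exact hy (mem_image_of_mem A (by simpa using h))
    have hval : ∀ l : ℝ, 0 ≤ l →
        polarFunction g (A u) ≤ Real.exp (-((‖u‖ ^ 2 - ‖u‖) * l)) * Real.exp (-t) := by
      intro l hl
      obtain ⟨x, hx⟩ := (T.equivOfDetNeZero hT).surjective (l • u)
      have hTx : T x = l • u := hx
      refine (hle x _).trans (le_of_eq ?_)
      simp only [hg]
      rw [hA, LinearMap.adjoint_inner_right, hTx, inner_smul_left, real_inner_self_eq_norm_sq,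
        norm_smul, Real.norm_of_nonneg hl, ← Real.exp_sub, ← Real.exp_add]
      simp only [conj_trivial]
      ring_nf
    have hpos' : 0 < ‖u‖ ^ 2 - ‖u‖ := by nlinarith
    have hlim : Tendsto (fun l : ℝ => Real.exp (-((‖u‖ ^ 2 - ‖u‖) * l)) * Real.exp (-t)) atTop
        (𝓝 0) := by
      simpa using (Real.tendsto_exp_neg_atTop_nhds_zero.comp
        (tendsto_id.const_mul_atTop hpos')).mul_const (Real.exp (-t))
    exact ge_of_tendsto hlim ((eventually_ge_atTop 0).mono hval)

/-- The John functions of the polar of `f` are the polars of the functions given by optimal centred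
majorants of `f`. -/
theorem isJohnFunction_polarFunction_iff {f h : EuclideanSpace ℝ (Fin n) → ℝ}
    (h0 : ∀ x, 0 ≤ f x) (hne : (Function.support f).Nonempty) (heven : ∀ x, f (-x) = f x)
    (hex : ∃ T t, IsEllipsoidalMajorant f T t ∧ LinearMap.det T ≠ 0) :
    IsJohnFunction (polarFunction f) h ↔ ∃ T t, IsOptimalMajorant f T t ∧
      h = polarFunction fun x => Real.exp (-‖T x‖ + t) := by
  have hequiv : ∀ T : EuclideanSpace ℝ (Fin n) →ₗ[ℝ] EuclideanSpace ℝ (Fin n),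
      LinearMap.det T ≠ 0 → ∃ A : EuclideanSpace ℝ (Fin n) ≃ᵃ[ℝ] EuclideanSpace ℝ (Fin n),
        LinearMap.det A.linear.toLinearMap = LinearMap.det T ∧
        ∀ u, A u = LinearMap.adjoint T u := by
    intro T hT
    rw [← LinearMap.det_adjoint_real] at hT ⊢
    obtain ⟨A, hA, hAx⟩ := exists_affineEquiv_eq hT
    exact ⟨A, by rw [hA], hAx⟩
  constructor
  · rintro ⟨A, s, rfl, hadm, hmax⟩
    have hdetA : 0 < |LinearMap.det A.linear.toLinearMap| :=
      abs_pos.2 (det_affineEquiv_linear_ne_zero A)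
    have hle : ∀ T' t', IsEllipsoidalMajorant f T' t' → LinearMap.det T' ≠ 0 →
        Real.exp (-t') * |LinearMap.det T'| ≤ s * |LinearMap.det A.linear.toLinearMap| := by
      intro T' t' hT' hdet'
      obtain ⟨A', hA', hA'x⟩ := hequiv T' hdet'
      have := hmax A' _ (hT'.johnAdmissible h0 hne hA'x)
      rwa [hA'] at this
    have hs : 0 < s := by
      obtain ⟨T', t', hT', hdet'⟩ := hex
      have h1 : 0 < Real.exp (-t') * |LinearMap.det T'| :=
        mul_pos (Real.exp_pos _) (abs_pos.2 hdet')
      exact pos_of_mul_pos_left (h1.trans_le (hle T' t' hT' hdet')) hdetA.le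
    set T := LinearMap.adjoint A.linear.toLinearMap with hT
    have hdetT : LinearMap.det T = LinearMap.det A.linear.toLinearMap :=
      LinearMap.det_adjoint_real _
    have hexps : Real.exp (-(-Real.log s)) = s := by rw [neg_neg, Real.exp_log hs]
    have hmaj := hadm.le_exp h0 hne heven hs
    rw [← hT] at hmaj
    have hopt : IsOptimalMajorant f T (-Real.log s) := by
      constructor
      · intro x
        refine (hmaj x).trans (Real.exp_le_exp.2 ?_)
        have := abs_nonneg (inner ℝ (A 0) x)
        linarith
      · intro T' t' hT'
        rw [hexps, hdetT]
        by_cases hdet' : LinearMap.det T' = 0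
        · rw [hdet', abs_zero, mul_zero]
          positivity
        · exact hle T' t' hT' hdet'
    have hdet0 : LinearMap.det T ≠ 0 := hopt.det_ne_zero hex
    have hzero : A 0 = 0 := by
      by_contra hne0
      obtain ⟨T', hT', hlt⟩ := LinearMap.exists_abs_det_lt_of_ne_zero hdet0 hne0
      have h1 := hopt.2 T' (-Real.log s) fun x =>
        (hmaj x).trans (Real.exp_le_exp.2 (by have := hT' x; linarith))
      exact absurd (le_of_mul_le_mul_left h1 (Real.exp_pos _)) (not_le.2 hlt)
    refine ⟨T, -Real.log s, hopt, ?_⟩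
    rw [polarFunction_exp_neg_norm hdet0 (-Real.log s) (A := A), hexps]
    intro u
    rw [affineEquiv_apply_eq, hzero, add_zero, hT, LinearMap.adjoint_adjoint]
  · rintro ⟨T, t, hopt, rfl⟩
    have hdet0 : LinearMap.det T ≠ 0 := hopt.det_ne_zero hex
    obtain ⟨A, hA, hAx⟩ := hequiv T hdet0
    refine ⟨A, Real.exp (-t), polarFunction_exp_neg_norm hdet0 t hAx,
      hopt.1.johnAdmissible h0 hne hAx, fun A' s' h' => ?_⟩
    rw [hA]
    rcases le_or_gt s' 0 with hs' | hs'
    · exact (mul_nonpos_of_nonpos_of_nonneg hs' (abs_nonneg _)).trans (by positivity)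
    · have h1 := hopt.2 (LinearMap.adjoint A'.linear.toLinearMap) (-Real.log s') fun x =>
        (h'.le_exp h0 hne heven hs' x).trans (Real.exp_le_exp.2 (by
          have := abs_nonneg (inner ℝ (A' 0) x)
          linarith))
      rwa [neg_neg, Real.exp_log hs', LinearMap.det_adjoint_real] at h1

end John

theorem mainTheorem5 (n : ℕ) (f : EuclideanSpace ℝ (Fin n) → ℝ)
    (hf : IsLogConcave f) (hint : Integrable f volume) (hnd : IsNondegenerate f)
    (heven : ∀ x, f (-x) = f x) :
    (∃! g, IsLownerFunction f g) ∧
    (∃! h, IsJohnFunction (polarFunction f) h) ∧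
    ∀ g h, IsLownerFunction f g → IsJohnFunction (polarFunction f) h →
      polarFunction g = h := by
  have h0 := hf.nonneg
  have hc := hf.concaveOn_log
  have hz := zero_mem_interior_support hc.1 heven hnd
  have hne : (Function.support f).Nonempty := ⟨0, interior_subset hz⟩
  obtain ⟨r, hr, δ, hδ, hball⟩ := exists_pos_le_on_ball h0 hc hz
  have hex : ∃ T t, IsEllipsoidalMajorant f T t ∧ LinearMap.det T ≠ 0 := by
    obtain ⟨c, hcpos, t, hct⟩ := exists_le_exp_neg_norm volume h0 hc heven hint hz
    refine ⟨c • LinearMap.id, t, fun x => ?_, ?_⟩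
    · simpa [norm_smul, abs_of_pos hcpos] using hct x
    · rw [LinearMap.det_smul, LinearMap.det_id, mul_one]
      positivity
  obtain ⟨T, t, hopt⟩ := exists_isOptimalMajorant hr hδ hball hex
  have huniq : ∀ T' t', IsOptimalMajorant f T' t' →
      (fun x => Real.exp (-‖T' x‖ + t')) = fun x => Real.exp (-‖T x‖ + t) := by
    intro T' t' h'
    obtain ⟨ht, hT⟩ := h'.unique hopt (h'.det_ne_zero hex) (hopt.det_ne_zero hex)
    ext x
    rw [ht, hT]
  have hL : ∀ g, IsLownerFunction f g ↔ g = fun x => Real.exp (-‖T x‖ + t) := by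
    intro g
    rw [isLownerFunction_iff heven hex]
    constructor
    · rintro ⟨T', t', h', rfl⟩
      exact huniq T' t' h'
    · exact fun hg => ⟨T, t, hopt, hg⟩
  have hJ : ∀ h, IsJohnFunction (polarFunction f) h ↔
      h = polarFunction fun x => Real.exp (-‖T x‖ + t) := by
    intro h
    rw [isJohnFunction_polarFunction_iff h0 hne heven hex]
    constructor
    · rintro ⟨T', t', h', rfl⟩
      rw [huniq T' t' h']
    · exact fun hh => ⟨T, t, hopt, hh⟩
  refine ⟨⟨_, (hL _).2 rfl, fun g hg => (hL g).1 hg⟩, ⟨_, (hJ _).2 rfl, fun h hh => (hJ h).1 hh⟩, ?_⟩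
  intro g h hg hh
  rw [(hL g).1 hg, (hJ h).1 hh]
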